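/- Let $G$ be a finite connected simple graph. For a vertex $v$ of $G$, let $N(v)$ denote its open neighborhood and $N[v]=N(v)\cup\{v\}$ its closed neighborhood. The graph $G$ has the partially augmented consecutive ones property (*-C1P) if there is a linear ordering of $V(G)$ such that, for every vertex $v$, at least one of the sets $N(v)$ and $N[v]$ consists of consecutive vertices in this ordering. The eccentricity of a path $P$ in $G$ is the maximum distance from a vertex of $G$ to (the nearest vertex of) $P$, and the path eccentricity $\operatorname{pe}(G)$ is the minimum eccentricity of a path in $G$. Theorem. If $G$ has the *-C1P, then $\operatorname{pe}(G)\le 1$. -/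

import Mathlib

namespace SimpleGraph

/-- The partially augmented consecutive ones property (*-C1P): the vertices can be linearly ordered
so that, for every vertex `v`, the open neighborhood `N(v)` or the closed neighborhood
`N[v] = {v} ∪ N(v)` is a set of consecutive vertices (it contains every vertex that lies between
two of its members). -/
def HasPartiallyAugmentedC1P {V : Type*} (G : SimpleGraph V) : Prop :=
  ∃ _ : LinearOrder V, ∀ v : V,
    (G.neighborSet v).OrdConnected ∨ (insert v (G.neighborSet v)).OrdConnected

/-- The distance from the vertex `w` to the path `p`: the minimum of the distances from `w`
to the vertices of `p`. -/
noncomputable def edistToPath {V : Type*} (G : SimpleGraph V) {u v : V} (w : V) (p : G.Path u v) :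
    ℕ∞ :=
  ⨅ x ∈ (p : G.Walk u v).support, G.edist w x

/-- The eccentricity of the path `p`: the maximum distance from a vertex of `G` to `p`. -/
noncomputable def eccentOfPath {V : Type*} (G : SimpleGraph V) {u v : V} (p : G.Path u v) : ℕ∞ :=
  ⨆ w : V, G.edistToPath w p

/-- The path eccentricity of `G`: the minimum eccentricity of a path in `G`
(a path may consist of a single vertex). -/
noncomputable def pathEccentricity {V : Type*} (G : SimpleGraph V) : ℕ∞ :=
  ⨅ (u : V) (v : V) (p : G.Path u v), G.eccentOfPath p

end SimpleGraph

namespace SimpleGraph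

open OrderDual

variable {V : Type*} {G : SimpleGraph V}

/-! Put a loop at each vertex whose closed neighborhood is an interval, so that all rows of the
adjacency relation are intervals. If a path misses `w`, every row of a path vertex lies on one side
of `w`. A row before `w` forces the next path vertex before `w`, which forces the row after that
before `w`, and so on: the side propagates, up to parity. A loop on the path removes the parity
ambiguity, so a path through a loop and through neighbors of both extreme vertices dominates
(`IsIntervalRel.isDominating`). Without loops the graph is bipartite, parity is harmless, and a path
through neighbors of the extremes of both parts dominates. That suitable paths exist follows from
connectivity: edges inside a quadrant of the matrix can leave it only if its corner entry is
present. -/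

/-- A path dominates `G` if every vertex is on the path or adjacent to one of its vertices. -/
def Path.IsDominating {u v : V} (p : G.Path u v) : Prop :=
  ∀ w, ∃ x ∈ (p : G.Walk u v).support, x = w ∨ G.Adj x w

theorem pathEccentricity_le_one_of_isDominating {u v : V} {p : G.Path u v}
    (hp : p.IsDominating) : G.pathEccentricity ≤ 1 := by
  refine (iInf_le _ u).trans ((iInf_le _ v).trans ((iInf_le _ p).trans (iSup_le fun w => ?_)))
  obtain ⟨x, hx, h⟩ := hp w
  refine (iInf₂_le x hx).trans ?_
  rcases h with rfl | h
  · simp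
  · exact (edist_eq_one_iff_adj.2 h.symm).le

/-! ### Propagation along walks and extension of paths -/

/-- A property that is transported along the edges between support vertices of a walk
is transported from any support vertex to any other. -/
theorem Walk.forall_mem_support_of_adj {T : V → Prop} {u v : V} (p : G.Walk u v)
    (hT : ∀ x ∈ p.support, ∀ y ∈ p.support, G.Adj x y → T x → T y)
    {x y : V} (hx : x ∈ p.support) (hy : y ∈ p.support) (h : T x) : T y := by
  have key : ∀ {u v : V} (p : G.Walk u v),
      (∀ x ∈ p.support, ∀ y ∈ p.support, G.Adj x y → T x → T y) →
      ∀ x ∈ p.support, (T u ↔ T x) := by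
    intro u v p
    induction p with
    | nil => intro _ x hx; simp at hx; rw [hx]
    | @cons a b c hab q ih =>
      intro hT x hx
      have hb : T a ↔ T b :=
        ⟨hT a (by simp) b (by simp) hab, hT b (by simp) a (by simp) hab.symm⟩
      rw [Walk.support_cons, List.mem_cons] at hx
      rcases hx with rfl | hx
      · rfl
      · exact hb.trans (ih (fun x hx y hy => hT x (by simp [hx]) y (by simp [hy])) x hx)
  exact (key p hT y hy).1 ((key p hT x hx).2 h)

theorem Connected.forall_of_adj (hG : G.Connected) {T : V → Prop}
    (hT : ∀ x y, G.Adj x y → T x → T y) {x y : V} (h : T x) : T y := by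
  obtain ⟨p⟩ := hG.preconnected x y
  exact p.forall_mem_support_of_adj (fun a _ b _ => hT a b) p.start_mem_support
    p.end_mem_support h

/-- A path can be extended at its start by a given neighbor, unless it already visits it. -/
theorem Path.exists_extend_start {u v u' : V} (p : G.Path u v) (h : G.Adj u' u) :
    ∃ (a : V) (q : G.Path a v), u' ∈ (q : G.Walk a v).support ∧
      ∀ x ∈ (p : G.Walk u v).support, x ∈ (q : G.Walk a v).support := by
  by_cases hu : u' ∈ (p : G.Walk u v).support
  · exact ⟨u, p, hu, fun _ hx => hx⟩
  · exact ⟨u', ⟨Walk.cons h p, p.2.cons hu⟩, by simp, fun x hx => by simp [hx]⟩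

theorem Path.exists_extend_end {u v v' : V} (p : G.Path u v) (h : G.Adj v v') :
    ∃ (b : V) (q : G.Path u b), v' ∈ (q : G.Walk u b).support ∧
      ∀ x ∈ (p : G.Walk u v).support, x ∈ (q : G.Walk u b).support := by
  obtain ⟨b, q, hq, hpq⟩ := p.reverse.exists_extend_start h.symm
  exact ⟨b, q.reverse, by simpa using hq, fun x hx => by simpa using hpq x (by simpa using hx)⟩

theorem Connected.exists_path (hG : G.Connected) (u v : V) : Nonempty (G.Path u v) := by
  classical
  obtain ⟨p⟩ := hG.preconnected u v
  exact ⟨p.toPath⟩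

/-! ### Adjacency with loops whose rows are intervals -/

section Interval

variable {β : Type*} [LinearOrder β]

/-- `M` is the adjacency relation of `G` with some loops added, and all its rows are intervals
with respect to the positions `f` of the vertices. -/
structure IsIntervalRel (G : SimpleGraph V) (M : V → V → Prop) (f : V → β) : Prop where
  adj : ∀ {u v}, G.Adj u v → M u v
  eq_or_adj : ∀ {u v}, M u v → u = v ∨ G.Adj u v
  symm : ∀ {u v}, M u v → M v u
  interval : ∀ {v x y z}, M v x → M v z → f x ≤ f y → f y ≤ f z → M v y

namespace IsIntervalRel

variable {M : V → V → Prop} {f : V → β}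

theorem dual (hM : G.IsIntervalRel M f) : G.IsIntervalRel M (toDual ∘ f) where
  adj := hM.adj
  eq_or_adj := hM.eq_or_adj
  symm := hM.symm
  interval hx hz hxy hyz := hM.interval hz hx hyz hxy

/-- The entry `(c, c)` lies in the quadrant of pairs at or beyond `n`. If the corner `(n, n)` were
absent, no edge could lead from this quadrant to a vertex before `n`, so by connectivity `n` would
have a neighbor in it, and the row of `n` would fill the corner. -/
theorem loop_of_le (hM : G.IsIntervalRel M f) (hG : G.Connected) {c n bot : V}
    (hbot : ∀ x, f bot ≤ f x) (hn : M n bot) (hc : M c c) (hnc : f n ≤ f c) : M n n := by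
  by_contra hnn
  obtain ⟨-, q, hq, hqn⟩ : f n ≤ f n ∧ ∃ q, f n ≤ f q ∧ M q n := by
    refine hG.forall_of_adj (T := fun p => f n ≤ f p ∧ ∃ q, f n ≤ f q ∧ M q p) (x := c) ?_
      ⟨hnc, c, hnc, hc⟩
    rintro p r hpr ⟨hp, q, hq, hqp⟩
    rcases le_total (f n) (f r) with hr | hr
    · exact ⟨hr, p, hp, hM.adj hpr⟩
    · have hpn : M p n := hM.interval (hM.adj hpr) (hM.symm hqp) hr hq
      exact absurd (hM.interval hn (hM.symm hpn) (hbot n) hp) hnn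
  exact hnn (hM.interval hn (hM.symm hqn) (hbot n) hq)

/-- The same argument in the square of pairs between `s` and `n`, which contains `(c, c)` and has
`(n, s)` as a corner. -/
theorem rel_of_mem_between (hM : G.IsIntervalRel M f) (hG : G.Connected) {c n s bot top : V}
    (hbot : ∀ x, f bot ≤ f x) (htop : ∀ x, f x ≤ f top) (hn : M n bot) (hs : M s top)
    (hc : M c c) (hsc : f s ≤ f c) (hcn : f c ≤ f n) : M n s := by
  by_contra hns
  obtain ⟨-, -, q, -, hq, hqs⟩ :
      f s ≤ f s ∧ f s ≤ f n ∧ ∃ q, f s ≤ f q ∧ f q ≤ f n ∧ M q s := by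
    refine hG.forall_of_adj
      (T := fun p => f s ≤ f p ∧ f p ≤ f n ∧ ∃ q, f s ≤ f q ∧ f q ≤ f n ∧ M q p)
      (x := c) ?_ ⟨hsc, hcn, c, hsc, hcn, hc⟩
    rintro p r hpr ⟨hp, hp', q, hq, hq', hqp⟩
    rcases le_total (f r) (f s) with hr | hr
    · have hps : M p s := hM.interval (hM.adj hpr) (hM.symm hqp) hr hq
      exact absurd (hM.symm (hM.interval (hM.symm hps) hs hp' (htop n))) hns
    rcases le_total (f n) (f r) with hr' | hr'
    · have hpn : M p n := hM.interval (hM.symm hqp) (hM.adj hpr) hq' hr'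
      exact absurd (hM.interval hn (hM.symm hpn) (hbot s) hp) hns
    · exact ⟨hr, hr', p, hp, hp', hM.adj hpr⟩
  exact hns (hM.symm (hM.interval (hM.symm hqs) hs hq (htop n)))

/-- A path through a looped vertex, a neighbor of the first and a neighbor of the last vertex
is dominating. -/
theorem isDominating (hM : G.IsIntervalRel M f) {c n s bot top u v : V}
    (hbot : ∀ x, f bot ≤ f x) (htop : ∀ x, f x ≤ f top) (hn : M n bot) (hs : M s top)
    (hc : M c c) (p : G.Path u v) (hcp : c ∈ (p : G.Walk u v).support)
    (hnp : n ∈ (p : G.Walk u v).support) (hsp : s ∈ (p : G.Walk u v).support) :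
    p.IsDominating := by
  intro w
  by_contra! hw
  have hw' : ∀ x ∈ (p : G.Walk u v).support, ¬ M x w := fun x hx hxw =>
    (hM.eq_or_adj hxw).elim (hw x hx).1 (hw x hx).2
  have row : ∀ {x t y}, x ∈ (p : G.Walk u v).support → M x t → M x y → f t ≤ f w → f y ≤ f w :=
    fun hx ht hy htw =>
      (le_total _ _).resolve_right fun hwy => hw' _ hx (hM.interval ht hy htw hwy)
  -- Each edge of the path swaps the two alternatives.
  have hcw : (∃ t, M c t ∧ f t ≤ f w) ∨ f c ≤ f w := by
    refine (p : G.Walk u v).forall_mem_support_of_adj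
      (T := fun x => (∃ t, M x t ∧ f t ≤ f w) ∨ f x ≤ f w) ?_ hnp hcp (.inl ⟨bot, hn, hbot w⟩)
    rintro x hx y hy hxy (⟨t, ht, htw⟩ | h)
    · exact .inr (row hx ht (hM.adj hxy) htw)
    · exact .inl ⟨x, hM.adj hxy.symm, h⟩
  -- The loop puts `c` in its own row, so both alternatives hold at `c` and propagate together to
  -- `s`, whose row reaches `top`.
  have hcw' : f c ≤ f w := hcw.elim (fun ⟨t, ht, htw⟩ => row hcp ht hc htw) id
  obtain ⟨⟨t, ht, htw⟩, -⟩ : (∃ t, M s t ∧ f t ≤ f w) ∧ f s ≤ f w := by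
    refine (p : G.Walk u v).forall_mem_support_of_adj
      (T := fun x => (∃ t, M x t ∧ f t ≤ f w) ∧ f x ≤ f w) ?_ hcp hsp ⟨⟨c, hc, hcw'⟩, hcw'⟩
    rintro x hx y hy hxy ⟨⟨t, ht, htw⟩, h⟩
    exact ⟨⟨x, hM.adj hxy.symm, h⟩, row hx ht (hM.adj hxy) htw⟩
  exact hw' s hsp (hM.interval ht hs htw (htop w))

theorem exists_isDominating [Finite V] (hM : G.IsIntervalRel M f) (hG : G.Connected)
    (hne : ∀ v, ∃ x, M v x) {c : V} (hc : M c c) :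
    ∃ (u v : V) (p : G.Path u v), p.IsDominating := by
  have := hG.nonempty
  obtain ⟨bot, hbot⟩ := Finite.exists_min f
  obtain ⟨top, htop⟩ := Finite.exists_max f
  obtain ⟨n, hn⟩ := hne bot
  obtain ⟨s, hs⟩ := hne top
  replace hn := hM.symm hn
  replace hs := hM.symm hs
  obtain ⟨q⟩ := hG.exists_path n s
  have hqn : n ∈ (q : G.Walk n s).support := Walk.start_mem_support _
  have hqs : s ∈ (q : G.Walk n s).support := Walk.end_mem_support _
  rcases le_total (f n) (f c) with hnc | hcn
  · exact ⟨n, s, q, hM.isDominating hbot htop hn hs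
      (hM.loop_of_le hG hbot hn hc hnc) q hqn hqn hqs⟩
  rcases le_total (f c) (f s) with hcs | hsc
  · exact ⟨n, s, q, hM.isDominating hbot htop hn hs
      (hM.dual.loop_of_le hG htop hs hc hcs) q hqs hqn hqs⟩
  obtain ⟨p⟩ := hG.exists_path s c
  have hps : s ∈ (p : G.Walk s c).support := Walk.start_mem_support _
  have hpc : c ∈ (p : G.Walk s c).support := Walk.end_mem_support _
  rcases hM.eq_or_adj (hM.rel_of_mem_between hG hbot htop hn hs hc hsc hcn) with rfl | hns
  · exact ⟨n, c, p, hM.isDominating hbot htop hn hs hc p hpc hps hps⟩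
  · obtain ⟨a, p', hnp', hpp'⟩ := p.exists_extend_start hns
    exact ⟨a, c, p', hM.isDominating hbot htop hn hs hc p' (hpp' c hpc) hnp' (hpp' s hps)⟩

end IsIntervalRel

end Interval

/-! ### Biconvex bipartite graphs -/

section Biconvex

variable {β γ : Type*} [LinearOrder β] [LinearOrder γ]

/-- `G` is bipartite with parts `L` and `Lᶜ`, and all neighborhoods are intervals with respect to
the positions `f` of the vertices of `L` and the positions `g` of the vertices of `Lᶜ`. -/
structure IsBiconvex (G : SimpleGraph V) (L : Set V) (f : V → β) (g : V → γ) : Prop where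
  bipartite : ∀ {u v}, G.Adj u v → (u ∈ L ↔ v ∉ L)
  left : ∀ {v x y z}, y ∈ L → G.Adj v x → G.Adj v z → v ∉ L → f x ≤ f y → f y ≤ f z → G.Adj v y
  right : ∀ {v x y z}, y ∉ L → G.Adj v x → G.Adj v z → v ∈ L → g x ≤ g y → g y ≤ g z → G.Adj v y

namespace IsBiconvex

variable {L : Set V} {f : V → β} {g : V → γ}

theorem dual_left (h : G.IsBiconvex L f g) : G.IsBiconvex L (toDual ∘ f) g where
  bipartite := h.bipartite
  left hy hx hz hv hxy hyz := h.left hy hz hx hv hyz hxy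
  right := h.right

theorem dual_right (h : G.IsBiconvex L f g) : G.IsBiconvex L f (toDual ∘ g) where
  bipartite := h.bipartite
  left := h.left
  right hy hx hz hv hxy hyz := h.right hy hz hx hv hyz hxy

theorem swap (h : G.IsBiconvex L f g) : G.IsBiconvex Lᶜ g f where
  bipartite huv := by simpa using not_congr (h.bipartite huv)
  left hy hx hz hv hxy hyz := h.right hy hx hz (by simpa using hv) hxy hyz
  right hy hx hz hv hxy hyz := h.left (by simpa using hy) hx hz hv hxy hyz

/-- The edge `q p` lies in the quadrant at or after `s` in `L` and at or before `n` in `Lᶜ`;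
connectivity forces the corner, as in `IsIntervalRel.loop_of_le`. -/
theorem adj_corner (h : G.IsBiconvex L f g) (hG : G.Connected) {n s t m p q : V}
    (hs : s ∈ L) (hnt : G.Adj n t) (hn : n ∉ L) (hts : f t ≤ f s) (hsm : G.Adj s m)
    (hnm : g n ≤ g m) (hqp : G.Adj q p) (hq : q ∈ L) (hsq : f s ≤ f q) (hpn : g p ≤ g n) :
    G.Adj n s := by
  by_contra hns
  have hT : (s ∈ L ∧ f s ≤ f s ∧ ∃ y, G.Adj s y ∧ g y ≤ g n) ∨
      (s ∉ L ∧ g s ≤ g n ∧ ∃ y, G.Adj s y ∧ f s ≤ f y) := by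
    refine hG.forall_of_adj (T := fun x => (x ∈ L ∧ f s ≤ f x ∧ ∃ y, G.Adj x y ∧ g y ≤ g n) ∨
      (x ∉ L ∧ g x ≤ g n ∧ ∃ y, G.Adj x y ∧ f s ≤ f y)) (x := q) ?_ (.inl ⟨hq, hsq, p, hqp, hpn⟩)
    rintro x r hxr (⟨hx, hsx, y, hxy, hyn⟩ | ⟨hx, hxn, y, hxy, hsy⟩)
    · rcases le_total (g r) (g n) with hr | hr
      · exact .inr ⟨(h.bipartite hxr).1 hx, hr, x, hxr.symm, hsx⟩
      · have hxn := h.right hn hxy hxr hx hyn hr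
        exact absurd (h.left hs hnt hxn.symm hn hts hsx) hns
    · have hr' : r ∈ L := (h.bipartite hxr.symm).2 hx
      rcases le_total (f s) (f r) with hr | hr
      · exact .inl ⟨hr', hr, x, hxr.symm, hxn⟩
      · have hxs := h.left hs hxr hxy hx hr hsy
        exact absurd (h.right hn hxs.symm hsm hs hxn hnm).symm hns
  rcases hT with ⟨-, -, y, hsy, hyn⟩ | ⟨hs', -⟩
  · exact hns (h.right hn hsy hsm hs hyn hnm).symm
  · exact hs' hs

/-- Bipartiteness fixes the parity: sides of `w` pass between rows of vertices outside `L` and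
positions of vertices in `L`, so no loop is needed. -/
theorem exists_adj_of_mem (h : G.IsBiconvex L f g) {u v : V} (p : G.Walk u v) {n n' t a w : V}
    (hn : n ∈ p.support) (hn' : n' ∈ p.support) (hnt : G.Adj n t) (hna : G.Adj n' a)
    (ht : t ∈ L) (ha : a ∈ L) (hw : w ∈ L) (htw : f t ≤ f w) (hwa : f w ≤ f a) :
    ∃ x ∈ p.support, G.Adj x w := by
  by_contra! hne
  have hnL : n ∉ L := (h.bipartite hnt.symm).1 ht
  have hnL' : n' ∉ L := (h.bipartite hna.symm).1 ha
  have hT : (n' ∉ L ∧ ∃ y, G.Adj n' y ∧ f y ≤ f w) ∨ (n' ∈ L ∧ f n' ≤ f w) := by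
    refine p.forall_mem_support_of_adj
      (T := fun x => (x ∉ L ∧ ∃ y, G.Adj x y ∧ f y ≤ f w) ∨ (x ∈ L ∧ f x ≤ f w)) ?_ hn hn'
      (.inl ⟨hnL, t, hnt, htw⟩)
    rintro x hx r hr hxr (⟨hxL, y, hxy, hyw⟩ | ⟨hxL, hxw⟩)
    · refine .inr ⟨(h.bipartite hxr.symm).2 hxL, (le_total _ _).resolve_right fun hwr => ?_⟩
      exact hne x hx (h.left hw hxy hxr hxL hyw hwr)
    · exact .inl ⟨(h.bipartite hxr).1 hxL, x, hxr.symm, hxw⟩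
  rcases hT with ⟨-, y, hy, hyw⟩ | ⟨hL, -⟩
  · exact hne n' hn' (h.left hw hy hna hnL' hyw hwa)
  · exact hnL' hL

theorem exists_isDominating_of_le (h : G.IsBiconvex L f g) (hG : G.Connected)
    {t a b m n n' s s' : V} (ht : t ∈ L) (ha : a ∈ L) (hb : b ∉ L) (hm : m ∉ L)
    (htL : ∀ x ∈ L, f t ≤ f x) (haL : ∀ x ∈ L, f x ≤ f a)
    (hbL : ∀ x ∉ L, g b ≤ g x) (hmL : ∀ x ∉ L, g x ≤ g m)
    (hn : G.Adj n t) (hn' : G.Adj n' a) (hs : G.Adj s m) (hs' : G.Adj s' b)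
    (hle : g n' ≤ g n) : ∃ (u v : V) (p : G.Path u v), p.IsDominating := by
  have hnL : n ∉ L := (h.bipartite hn.symm).1 ht
  have hnL' : n' ∉ L := (h.bipartite hn'.symm).1 ha
  have hsL : s ∈ L := (h.bipartite hs).2 hm
  have hsL' : s' ∈ L := (h.bipartite hs').2 hb
  have hns : G.Adj n s := h.adj_corner hG hsL hn hnL (htL s hsL) hs (hmL n hnL) hn'.symm ha
    (haL s hsL) hle
  have hns' : G.Adj n' s' := h.dual_left.dual_right.adj_corner hG hsL' hn' hnL' (haL s' hsL') hs'
    (hbL n' hnL') hn.symm ht (htL s' hsL') hle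
  -- The two corner edges extend a path from `n` to `n'` to one that also visits `s` and `s'`.
  obtain ⟨p₀⟩ := hG.exists_path n n'
  obtain ⟨u, p₁, hsp₁, h₁⟩ := p₀.exists_extend_start hns.symm
  obtain ⟨v, p, hsp', h₂⟩ := p₁.exists_extend_end hns'
  have hnp := h₂ n (h₁ n (Walk.start_mem_support _))
  have hnp' := h₂ n' (h₁ n' (Walk.end_mem_support _))
  have hsp := h₂ s hsp₁
  refine ⟨u, v, p, fun w => ?_⟩
  by_cases hw : w ∈ L
  · obtain ⟨x, hx, hxw⟩ := h.exists_adj_of_mem p.1 hnp hnp' hn hn' ht ha hw (htL w hw)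
      (haL w hw)
    exact ⟨x, hx, .inr hxw⟩
  · obtain ⟨x, hx, hxw⟩ := h.swap.exists_adj_of_mem p.1 hsp' hsp hs' hs hb hm hw (hbL w hw)
      (hmL w hw)
    exact ⟨x, hx, .inr hxw⟩

theorem exists_isDominating [Finite V] (h : G.IsBiconvex L f g) (hG : G.Connected)
    (hne : ∀ v, ∃ x, G.Adj x v) : ∃ (u v : V) (p : G.Path u v), p.IsDominating := by
  have hL : L.Nonempty ∧ Lᶜ.Nonempty := by
    obtain ⟨v⟩ := hG.nonempty
    obtain ⟨x, hx⟩ := hne v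
    by_cases hv : v ∈ L
    · exact ⟨⟨v, hv⟩, x, (h.bipartite hx.symm).1 hv⟩
    · exact ⟨⟨x, (h.bipartite hx).2 hv⟩, v, hv⟩
  obtain ⟨t, ht, htL⟩ := Set.exists_min_image L f L.toFinite hL.1
  obtain ⟨a, ha, haL⟩ := Set.exists_max_image L f L.toFinite hL.1
  obtain ⟨b, hb, hbL⟩ := Set.exists_min_image Lᶜ g Lᶜ.toFinite hL.2
  obtain ⟨m, hm, hmL⟩ := Set.exists_max_image Lᶜ g Lᶜ.toFinite hL.2
  obtain ⟨n, hn⟩ := hne t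
  obtain ⟨n', hn'⟩ := hne a
  obtain ⟨s, hs⟩ := hne m
  obtain ⟨s', hs'⟩ := hne b
  rcases le_total (g n') (g n) with hle | hle
  · exact h.exists_isDominating_of_le hG ht ha hb hm htL haL hbL hmL hn hn' hs hs' hle
  · exact h.dual_right.exists_isDominating_of_le hG ht ha hm hb htL haL hmL hbL hn hn' hs' hs hle

end IsBiconvex

end Biconvex

/-! ### Reduction of the *-C1P to the two cases -/

/-- If every open neighborhood is an interval, then `G` is biconvex:
one part consists of the vertices that lie before their neighbors, the other of those that
lie after them. -/
theorem isBiconvex_of_ordConnected [LinearOrder V] (h : ∀ v, (G.neighborSet v).OrdConnected) :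
    G.IsBiconvex {v | ∃ y, G.Adj v y ∧ v < y} id id := by
  have hconv : ∀ {v x y z : V}, G.Adj v x → G.Adj v z → x ≤ y → y ≤ z → G.Adj v y :=
    fun {v _ _ _} hx hz hxy hyz => (h v).out hx hz ⟨hxy, hyz⟩
  refine ⟨fun {u v} huv => ?_, fun _ hx hz _ => hconv hx hz, fun _ hx hz _ => hconv hx hz⟩
  -- A vertex between two of its neighbors would be adjacent to itself.
  have hlt : ∀ {x y z : V}, G.Adj x y → G.Adj x z → x < y → x < z := fun {x y z} hy hz hxy =>
    lt_of_not_ge fun hzx => G.irrefl (hconv hz hy hzx hxy.le)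
  constructor
  · rintro ⟨y, huy, hy⟩ ⟨z, hvz, hz⟩
    exact lt_asymm (hlt huy huv hy) (hlt hvz huv.symm hz)
  · intro hv
    exact ⟨v, huv, (lt_or_gt_of_ne huv.ne).resolve_right fun hvu => hv ⟨u, huv.symm, hvu⟩⟩

/-- A connected graph with the partially augmented consecutive ones property
has a dominating path. -/
theorem HasPartiallyAugmentedC1P.exists_isDominating [Finite V] (h : G.HasPartiallyAugmentedC1P)
    (hG : G.Connected) : ∃ (u v : V) (p : G.Path u v), p.IsDominating := by
  obtain ⟨_, h⟩ := h
  -- This covers the one-vertex graph, whose vertex gets a loop.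
  have hne : ∀ v, (insert v (G.neighborSet v)).OrdConnected ∨ ∃ x, G.Adj x v := by
    intro v
    by_cases hv : ∃ x, G.Adj x v
    · exact .inr hv
    · have : G.neighborSet v = ∅ := Set.eq_empty_of_forall_notMem fun x hx => hv ⟨x, hx.symm⟩
      left
      rw [this, insert_empty_eq]
      exact Set.ordConnected_singleton
  by_cases hc : ∃ c, (insert c (G.neighborSet c)).OrdConnected
  · obtain ⟨c, hc⟩ := hc
    have hM : G.IsIntervalRel
        (fun u v => G.Adj u v ∨ (u = v ∧ (insert u (G.neighborSet u)).OrdConnected)) id := by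
      refine ⟨.inl, fun h => h.symm.imp_left And.left, ?_, ?_⟩
      · rintro u v (huv | ⟨rfl, hu⟩)
        · exact .inl huv.symm
        · exact .inr ⟨rfl, hu⟩
      · intro v x y z hx hz hxy hyz
        by_cases hv : (insert v (G.neighborSet v)).OrdConnected
        · have hmem : ∀ {x}, G.Adj v x ∨ (v = x ∧ (insert v (G.neighborSet v)).OrdConnected) →
              x ∈ insert v (G.neighborSet v) := by
            rintro x (hx | ⟨rfl, -⟩)
            · exact .inr hx
            · exact .inl rfl
          rcases hv.out (hmem hx) (hmem hz) ⟨hxy, hyz⟩ with hy | hy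
          · exact .inr ⟨hy.symm, hv⟩
          · exact .inl hy
        · exact .inl (((h v).resolve_right hv).out (hx.resolve_right fun hx => hv hx.2)
            (hz.resolve_right fun hz => hv hz.2) ⟨hxy, hyz⟩)
    refine hM.exists_isDominating hG (fun v => ?_) (c := c) (.inr ⟨rfl, hc⟩)
    rcases hne v with hv | ⟨x, hx⟩
    · exact ⟨v, .inr ⟨rfl, hv⟩⟩
    · exact ⟨x, .inl hx.symm⟩
  · push Not at hc
    exact (isBiconvex_of_ordConnected fun v => (h v).resolve_right (hc v)).exists_isDominating hG
      fun v => (hne v).resolve_left (hc v)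

end SimpleGraph

theorem theorem5 {V : Type*} [Finite V] (G : SimpleGraph V) (hconn : G.Connected)
    (hG : G.HasPartiallyAugmentedC1P) : G.pathEccentricity ≤ 1 := by
  obtain ⟨u, v, p, hp⟩ := hG.exists_isDominating hconn
  exact SimpleGraph.pathEccentricity_le_one_of_isDominating hp
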